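/- **Theorem (Convergence of iterates).** Let $p$ be a probability density on $\mathbb{R}^d$ (with respect to Lebesgue measure) with bounded support: $\Pr_{X\sim p}(\|X\|>R)=0$ for some $R>0$. For $w=(w_1,\dots,w_k)\in\mathbb{R}^{k\times d}$ let $$V_i(w)=\{x:\ \|w_i-x\|\le\|w_j-x\|\ \text{for all } j\},\qquad P_i(w)=\int_{V_i(w)}p(x)\,dx,\qquad f(w)=\frac12\sum_{i=1}^k\int_{V_i(w)}\|w_i-x\|^2p(x)\,dx ,$$ and let $\mathcal{D}_R$ be the set of tuples of pairwise distinct centers in the closed ball $B(0,R)$. Assume that the set $\{w\in\mathcal{D}_R:\nabla f(w)=0\}$ of stationary points of the $k$-means cost $f$ is compact. Let $W^{(n)}$ be generated by the generalized online $k$-means algorithm: $W^{(0)}$ consists of $k$ distinct centers in the support of $p$ and, for $n\ge0$ and $i\in[k]$, $$W_i^{(n+1)}=W_i^{(n)}-H_i^{(n+1)}\bigl(W_i^{(n)}-X_i^{(n+1)}\bigr),$$ where, with $\mathcal{F}_0=\sigma(W^{(0)})$ and $\mathcal{F}_{n+1}=\sigma(X^{(n+1)},H^{(n+1)},\mathcal{F}_n)$,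 the conditional law of $X_i^{(n+1)}$ given $\mathcal{F}_n$ is $p$ restricted to $V_i(W^{(n)})$ and normalised, whenever $P_i(W^{(n)})>0$. Assume of the (random) learning rates that almost surely $H_i^{(n+1)}=0$ whenever $P_i(W^{(n)})=0$; that $H^{(n+1)}$ and $X^{(n+1)}$ are conditionally independent given $\mathcal{F}_n$; that $0\le H_i^{(n+1)}\le1$ almost surely; and that $\sum_{n\ge1}\sum_{i}(H_i^{(n)})^2<\infty$ almost surely. Suppose that for all $i\in[k]$ and $\epsilon>0$ there is $r_0>0$ such that for every $r\in(0,r_0)$ there exist $T:\mathbb{N}\to\mathbb{N}$, $m_0\in\mathbb{N}$ and $s,c>0$ such that for every $m>m_0$, almost surely on the event $\{\|\nabla_{w_i}f(W^{(m)})\|>\epsilon\}$, $$\Pr\Bigl(\ \sum_{j\in[k]}\ \sum_{m\le n<T(m)}H_j^{(n+1)}<r\quad\text{and}\quad\sum_{m\le n<T(m)}H_i^{(n+1)}>s\ \Bigm|\ \mathcal{F}_m\Bigr)>c .$$ Then, almost surely, $W^{(n)}$ asymptotically converges to stationary points of $f$: the sequence $(W^{(n)})_{n\ge0}$ stays in $\mathcal{D}_R$,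 and all of its limit points in the space $\mathcal{D}_R$ are stationary points of $f$, $$\bigcap_{n\ge0}\overline{\{W^{(n')}:n'\ge n\}}\subset\{\nabla f=0\}\qquad\text{(closures taken in }\mathcal{D}_R).$$ -/

import Mathlib

open MeasureTheory ProbabilityTheory Set Filter Topology

noncomputable section

namespace KMeans

/-- The data space `ℝ^d` with its Euclidean norm. -/
abbrev Pt (d : ℕ) : Type := EuclideanSpace ℝ (Fin d)

/-- A `k`-tuple of centers `w = (w_1, …, w_k)` in `ℝ^d`. -/
abbrev Centers (k d : ℕ) : Type := Fin k → Pt d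

/-- `p` is a probability density on `ℝ^d` with respect to Lebesgue measure. -/
structure IsDensity {d : ℕ} (p : Pt d → ℝ) : Prop where
  measurable : Measurable p
  nonneg : ∀ x, 0 ≤ p x
  total : ∫⁻ x, ENNReal.ofReal (p x) = 1

/-- The distribution `p(x) dx` on `ℝ^d`. -/
def law {d : ℕ} (p : Pt d → ℝ) : Measure (Pt d) :=
  (volume : Measure (Pt d)).withDensity fun x => ENNReal.ofReal (p x)

/-- The (closed) Voronoi cell `V_i(w)`: the points for which `w_i` is a closest center. -/
def voronoi {k d : ℕ} (w : Centers k d) (i : Fin k) : Set (Pt d) :=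
  {x | ∀ j, ‖w i - x‖ ≤ ‖w j - x‖}

/-- The probability mass `P_i(w)` of the Voronoi cell `V_i(w)`. -/
def mass {k d : ℕ} (p : Pt d → ℝ) (w : Centers k d) (i : Fin k) : ℝ :=
  (law p).real (voronoi w i)

/-- The `k`-means cost `f(w) = (1/2) ∑ i, ∫_{V_i(w)} ‖w_i - x‖² p(x) dx`. -/
def cost {k d : ℕ} (p : Pt d → ℝ) (w : Centers k d) : ℝ :=
  (1 / 2 : ℝ) * ∑ i, ∫ x in voronoi w i, ‖w i - x‖ ^ 2 ∂(law p)

/-- The gradient `∇_{w_i} f(w)` of the cost with respect to the `i`-th center. -/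
def gradCost {k d : ℕ} (p : Pt d → ℝ) (i : Fin k) (w : Centers k d) : Pt d :=
  gradient (fun y : Pt d => cost p (Function.update w i y)) (w i)

/-- The set `𝒟` of non-degenerate tuples: pairwise distinct centers. -/
def nondegenerate (k d : ℕ) : Set (Centers k d) :=
  {w | ∀ i j, i ≠ j → w i ≠ w j}

/-- The set `𝒟_R` of non-degenerate tuples of centers in the closed ball `B(0, R)`. -/
def nondegenerateIn (k d : ℕ) (R : ℝ) : Set (Centers k d) :=
  {w | w ∈ nondegenerate k d ∧ ∀ i, ‖w i‖ ≤ R}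

/-- The stationary points of `g`: `g` is differentiable there, with derivative zero. -/
def stationary {k d : ℕ} (g : Centers k d → ℝ) : Set (Centers k d) :=
  {w | HasFDerivAt g (0 : Centers k d →L[ℝ] ℝ) w}

/-- The sequence `w` lies in `S`, and all its limit points in the topological subspace `S`
are stationary points of `g`.  (The closure of `A ⊆ S` in the subspace `S` is
`S ∩ closure A`.) -/
def AsymptoticallyStationary {k d : ℕ} (S : Set (Centers k d)) (g : Centers k d → ℝ)
    (w : ℕ → Centers k d) : Prop :=
  (∀ n, w n ∈ S) ∧ (⋂ n : ℕ, S ∩ closure (w '' Ici n)) ⊆ stationary g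

/-- The natural filtration: `ℱ_0 = σ(W^(0))` and `ℱ_{n+1} = σ(X^(n+1), H^(n+1), ℱ_n)`. -/
@[reducible]
def history {Ω : Type*} {k d : ℕ} (W X : ℕ → Ω → Centers k d) (H : ℕ → Ω → Fin k → ℝ) :
    ℕ → MeasurableSpace Ω
  | 0 => MeasurableSpace.comap (W 0) inferInstance
  | n + 1 => history W X H n ⊔ MeasurableSpace.comap (X (n + 1)) inferInstance ⊔
      MeasurableSpace.comap (H (n + 1)) inferInstance

/-- Conditional independence of two random variables given a sub-σ-algebra `m`, through
conditional probabilities (on an arbitrary probability space; on a standard Borel space this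
is the same as `ProbabilityTheory.CondIndepFun`). -/
def CondIndepGiven {Ω β γ : Type*} [MeasurableSpace β] [MeasurableSpace γ]
    (m : MeasurableSpace Ω) [mΩ : MeasurableSpace Ω] (Y : Ω → β) (Z : Ω → γ) (μ : Measure Ω) :
    Prop :=
  ∀ (A : Set β) (B : Set γ), MeasurableSet A → MeasurableSet B →
    μ⟦Y ⁻¹' A ∩ Z ⁻¹' B | m⟧ =ᵐ[μ] fun ω => (μ⟦Y ⁻¹' A | m⟧) ω * (μ⟦Z ⁻¹' B | m⟧) ω

/-- `W, X, H` is a run of the generalized online `k`-means algorithm for the density `p`: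
the initial centers are distinct and lie in the support of `p`; given the past, `X_i^(n+1)` is
drawn from `p` restricted to `V_i(W^(n))` (and normalised) whenever that cell has positive
mass; and `W_i^(n+1) = W_i^(n) - H_i^(n+1) (W_i^(n) - X_i^(n+1))`.
The values `X 0` and `H 0` are not used. -/
structure IsOnlineKMeans {Ω : Type*} [MeasurableSpace Ω] {k d : ℕ} (μ : Measure Ω)
    (p : Pt d → ℝ) (W X : ℕ → Ω → Centers k d) (H : ℕ → Ω → Fin k → ℝ) : Prop where
  measurable_init : Measurable (W 0)
  measurable_sample : ∀ n, Measurable (X (n + 1))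
  measurable_rate : ∀ n, Measurable (H (n + 1))
  init_distinct : ∀ᵐ ω ∂μ, W 0 ω ∈ nondegenerate k d
  init_support : ∀ᵐ ω ∂μ, ∀ i, W 0 ω i ∈ (law p).support
  sample : ∀ (n : ℕ) (i : Fin k) (A : Set (Pt d)), MeasurableSet A →
    ∀ᵐ ω ∂μ, 0 < mass p (W n ω) i →
      (μ⟦(fun ω' => X (n + 1) ω' i) ⁻¹' A | history W X H n⟧) ω =
        ((law p)[|voronoi (W n ω) i]).real A
  update : ∀ (n : ℕ) (ω : Ω) (i : Fin k),
    W (n + 1) ω i = W n ω i - H (n + 1) ω i • (W n ω i - X (n + 1) ω i)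

/-- The standing assumptions on the learning rates: a center whose cell has no mass is not
updated; the rates and the samples of a step are conditionally independent given the past; and
the rates lie in `[0, 1]`. -/
structure RateAssumptions {Ω : Type*} [MeasurableSpace Ω] {k d : ℕ} (μ : Measure Ω)
    (p : Pt d → ℝ) (W X : ℕ → Ω → Centers k d) (H : ℕ → Ω → Fin k → ℝ) : Prop where
  zero_of_mass_zero : ∀ (n : ℕ) (i : Fin k),
    ∀ᵐ ω ∂μ, mass p (W n ω) i = 0 → H (n + 1) ω i = 0
  condIndep : ∀ n, CondIndepGiven (history W X H n) (H (n + 1)) (X (n + 1)) μ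
  mem_Icc : ∀ (n : ℕ) (i : Fin k), ∀ᵐ ω ∂μ, 0 ≤ H (n + 1) ω i ∧ H (n + 1) ω i ≤ 1

/-- The event that, over the window `[m, t)`, the rates of all centers sum to less than `r`
while the rates of center `i` sum to more than `s`. -/
def windowEvent {Ω : Type*} {k : ℕ} (H : ℕ → Ω → Fin k → ℝ) (i : Fin k) (m t : ℕ)
    (r s : ℝ) : Set Ω :=
  {ω | (∑ j, ∑ n ∈ Finset.Ico m t, H (n + 1) ω j) < r ∧
    s < ∑ n ∈ Finset.Ico m t, H (n + 1) ω i}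

end KMeans

end

/-!
Write `g_i(w) = ∫_{V_i(w)} (w_i - x) p(x) dx` (`cellMoment`).

*Geometry.* Moving the centers from `w` to `w'` with the cells of `w` kept fixed gives the upper
bound `f(w') ≤ f(w) + ∑ i, (⟪g_i(w), w'_i - w_i⟫ + ‖w'_i - w_i‖² / 2)` as soon as the centers of
`w'` are distinct (`cost_le`). Bisectors of distinct points are null sets, so `g_i` is continuous
at tuples of distinct centers, and the bound used in both directions shows that `f` is
differentiable there with partial gradients `g_i` (`hasFDerivAt_cost`, `gradCost_eq_cellMoment`).

*One step.* Conditional independence means that, given the past and the rates of a step, `X_i` is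
distributed as `p` conditioned on `V_i(W^(n))` (`map_centers_rate_sample`). Hence samples almost
surely lie in the interior of their cells, which keeps the centers distinct
(`ae_mem_nondegenerateIn`), and the displacement `W_i - X_i` has conditional mean `g_i / P_i`, where
`P_i ≤ 1`. So a step is expected to decrease `f` by at least `∑ i, H_i ‖g_i‖²`, up to an error
`2R² ∑ i, H_i²`.

*Summability.* The errors accumulated so far, minus the decreases `∑ i, H_i ‖g_i‖²` accumulated so
far, minus the current cost, form a submartingale with bounded increments. It is almost surely
bounded above because the squared rates are summable; hence it converges, and
`∑ n, ∑ i, H_i^(n+1) ‖g_i(W^(n))‖² < ∞` almost surely (`ae_summable_gain`).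

*Limit points.* Let `w₀` have distinct centers and `g_i(w₀) ≠ 0`. By continuity `‖g_i‖ > ε` on a
ball about `w₀`. When `W^(m)` is in the ball of half the radius, the window hypothesis with `r`
small gives, with conditional probability at least `c`, a window during which the centers stay in
the large ball while the rates of center `i` add up to `s`; such a window contributes at least
`s ε²` to the convergent series. By Lévy's upward theorem this can happen for only finitely
many `m` (`ae_eventually_notMem_of_condProb`). Countably many such balls cover the non-stationary
tuples of distinct centers, so almost surely none of these is a limit point.
-/

namespace KMeans

section Cells

variable {k d : ℕ} {p : Pt d → ℝ} {R : ℝ}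

/-! ### Voronoi cells and the law of the data -/

lemma isProbabilityMeasure_law (hp : IsDensity p) : IsProbabilityMeasure (law p) :=
  ⟨by rw [law, withDensity_apply _ MeasurableSet.univ, Measure.restrict_univ, hp.total]⟩

lemma ae_norm_le (hsupp : law p {x | R < ‖x‖} = 0) : ∀ᵐ x ∂law p, ‖x‖ ≤ R := by
  simpa [ae_iff] using hsupp

lemma ae_norm_sub_ne (p : Pt d → ℝ) {a b : Pt d} (hab : a ≠ b) :
    ∀ᵐ x ∂law p, ‖a - x‖ ≠ ‖b - x‖ := by
  refine (withDensity_absolutelyContinuous _ _).ae_le ?_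
  have h := Measure.addHaar_affineSubspace (volume : Measure (Pt d))
    (AffineSubspace.perpBisector a b) (by simpa using hab)
  change ∀ᵐ x ∂volume, ‖a - x‖ ≠ ‖b - x‖
  rw [ae_iff]
  convert h using 2
  ext x
  simp [AffineSubspace.mem_perpBisector_iff_dist_eq', dist_eq_norm]

/-- For distinct centers, almost every data point lies in at most one cell. -/
lemma ae_forall_norm_sub_ne (p : Pt d → ℝ) {w : Centers k d} (hw : w ∈ nondegenerate k d) :
    ∀ᵐ x ∂law p, ∀ i j, i ≠ j → ‖w i - x‖ ≠ ‖w j - x‖ := by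
  simp only [ae_all_iff]
  exact fun i j hij => ae_norm_sub_ne p (hw i j hij)

lemma measurableSet_mem_voronoi (i : Fin k) :
    MeasurableSet {q : Centers k d × Pt d | q.2 ∈ voronoi q.1 i} := by
  have : {q : Centers k d × Pt d | q.2 ∈ voronoi q.1 i}
      = ⋂ j, {q | ‖q.1 i - q.2‖ ≤ ‖q.1 j - q.2‖} := by
    ext; simp [voronoi]
  rw [this]
  exact MeasurableSet.iInter fun j => measurableSet_le (by fun_prop) (by fun_prop)

lemma measurableSet_voronoi (w : Centers k d) (i : Fin k) : MeasurableSet (voronoi w i) :=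
  measurable_prodMk_left (measurableSet_mem_voronoi i)

lemma exists_mem_voronoi [Nonempty (Fin k)] (w : Centers k d) (x : Pt d) :
    ∃ i, x ∈ voronoi w i :=
  Finite.exists_min fun i => ‖w i - x‖

lemma isOpen_nondegenerate : IsOpen (nondegenerate k d) := by
  have : nondegenerate k d = ⋂ i, ⋂ j, {w | i ≠ j → w i ≠ w j} := by
    ext; simp [nondegenerate]
  rw [this]
  refine isOpen_iInter_of_finite fun i => isOpen_iInter_of_finite fun j => ?_
  by_cases hij : i = j
  · simp [hij]
  · simpa [hij] using isOpen_ne_fun (by fun_prop) (by fun_prop)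

/-- Away from ties at `w₀`, membership in a cell is locally constant in the centers. -/
lemma eventually_mem_voronoi_iff (w₀ : Centers k d) (x : Pt d) (i : Fin k)
    (hx : ∀ i j, i ≠ j → ‖w₀ i - x‖ ≠ ‖w₀ j - x‖) :
    ∀ᶠ w in 𝓝 w₀, (x ∈ voronoi w i ↔ x ∈ voronoi w₀ i) := by
  have hc : ∀ j, Continuous fun w : Centers k d => ‖w j - x‖ := fun j => by fun_prop
  by_cases h : x ∈ voronoi w₀ i
  · have : ∀ j, ∀ᶠ w in 𝓝 w₀, ‖w i - x‖ ≤ ‖w j - x‖ := by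
      intro j
      by_cases hij : i = j
      · simp [hij]
      · exact ((hc i).continuousAt.eventually_lt (hc j).continuousAt
          (lt_of_le_of_ne (h j) (hx i j hij))).mono fun w hw => hw.le
    filter_upwards [eventually_all.2 this] with w hw
    exact iff_of_true hw h
  · obtain ⟨j, hj⟩ : ∃ j, ‖w₀ j - x‖ < ‖w₀ i - x‖ := by simpa [voronoi] using h
    filter_upwards [(hc j).continuousAt.eventually_lt (hc i).continuousAt hj] with w hw
    exact iff_of_false (fun h' => absurd (h' j) (not_le.2 hw)) h

/-- The first moment `∫_{V_i(w)} (w_i - x) p(x) dx` of a cell about its center; for distinct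
centers it is the partial gradient of the cost. -/
noncomputable def cellMoment (p : Pt d → ℝ) (i : Fin k) (w : Centers k d) : Pt d :=
  ∫ x in voronoi w i, (w i - x) ∂law p

lemma cellMoment_eq_indicator (p : Pt d → ℝ) (i : Fin k) (w : Centers k d) :
    cellMoment p i w = ∫ x, (voronoi w i).indicator (fun x => w i - x) x ∂law p :=
  (integral_indicator (measurableSet_voronoi w i)).symm

lemma mass_nonneg (p : Pt d → ℝ) (w : Centers k d) (i : Fin k) : 0 ≤ mass p w i :=
  measureReal_nonneg

lemma mass_le_one (hp : IsDensity p) (w : Centers k d) (i : Fin k) : mass p w i ≤ 1 := by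
  have := isProbabilityMeasure_law hp
  exact measureReal_le_one

variable (hp : IsDensity p) (hsupp : law p {x | R < ‖x‖} = 0)

include hp hsupp

lemma integrable_sub (a : Pt d) : Integrable (fun x => a - x) (law p) := by
  have := isProbabilityMeasure_law hp
  refine Integrable.of_bound (by fun_prop) (‖a‖ + R) ?_
  filter_upwards [ae_norm_le hsupp] with x hx
  exact (norm_sub_le _ _).trans (by gcongr)

lemma integrable_norm_sub_sq (a : Pt d) : Integrable (fun x => ‖a - x‖ ^ 2) (law p) := by
  have := isProbabilityMeasure_law hp
  refine Integrable.of_bound (by fun_prop) ((‖a‖ + R) ^ 2) ?_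
  filter_upwards [ae_norm_le hsupp] with x hx
  rw [norm_pow, norm_norm]
  exact pow_le_pow_left₀ (norm_nonneg _) ((norm_sub_le _ _).trans (by gcongr)) 2

lemma norm_cellMoment_le (w : Centers k d) (i : Fin k) : ‖cellMoment p i w‖ ≤ ‖w i‖ + |R| := by
  have := isProbabilityMeasure_law hp
  have h : ‖cellMoment p i w‖ ≤ (‖w i‖ + |R|) * (law p).real (voronoi w i) := by
    refine norm_setIntegral_le_of_norm_le_const_ae (measure_lt_top _ _) ?_
    filter_upwards [ae_restrict_of_ae (ae_norm_le hsupp)] with x hx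
    exact (norm_sub_le _ _).trans (by gcongr; exact hx.trans (le_abs_self R))
  exact h.trans (mul_le_of_le_one_right (by positivity) measureReal_le_one)

/-- The partial gradients of the cost are continuous where the centers are distinct. -/
lemma continuousAt_cellMoment (i : Fin k) {w₀ : Centers k d} (hw₀ : w₀ ∈ nondegenerate k d) :
    ContinuousAt (cellMoment p i) w₀ := by
  have := isProbabilityMeasure_law hp
  simp only [funext (cellMoment_eq_indicator p i)]
  refine continuousAt_of_dominated (bound := fun _ => ‖w₀ i‖ + 1 + R) ?_ ?_ (by fun_prop) ?_
  · refine .of_forall fun w => ?_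
    exact ((Measurable.indicator (by fun_prop) (measurableSet_voronoi w i))).aestronglyMeasurable
  · have hc : Continuous fun w : Centers k d => ‖w i‖ := by fun_prop
    filter_upwards [hc.continuousAt.eventually_lt continuousAt_const
      (lt_add_one ‖w₀ i‖)] with w hw
    filter_upwards [ae_norm_le hsupp] with x hx
    exact (norm_indicator_le_norm_self _ _).trans
      ((norm_sub_le _ _).trans (by gcongr))
  · filter_upwards [ae_forall_norm_sub_ne p hw₀] with x hx
    have hev := eventually_mem_voronoi_iff w₀ x i hx
    have hc : ContinuousAt (fun w : Centers k d => (voronoi w₀ i).indicator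
        (fun _ => w i - x) x) w₀ := by
      by_cases h : x ∈ voronoi w₀ i
      · simp only [indicator_of_mem h]
        exact ((continuous_apply i).sub continuous_const).continuousAt
      · simp only [indicator_of_notMem h]
        exact continuousAt_const
    refine hc.congr ?_
    filter_upwards [hev] with w hw
    by_cases h : x ∈ voronoi w₀ i
    · rw [indicator_of_mem h, indicator_of_mem (hw.2 h)]
    · rw [indicator_of_notMem h, indicator_of_notMem (fun h' => h (hw.1 h'))]

/-! ### The cost and its gradient -/

/-- Assigning the data to the cells of other centers `w` can only increase the cost of `w'`. -/
lemma cost_le_sum_setIntegral {w' : Centers k d} (hw' : w' ∈ nondegenerate k d)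
    (w : Centers k d) :
    cost p w' ≤ (1 / 2 : ℝ) * ∑ i, ∫ x in voronoi w i, ‖w' i - x‖ ^ 2 ∂law p := by
  rcases isEmpty_or_nonempty (Fin k) with hk | hk
  · simp [cost]
  have hint : ∀ v : Centers k d, ∀ i ∈ Finset.univ, Integrable
      (fun x => (voronoi v i).indicator (fun x => ‖w' i - x‖ ^ 2) x) (law p) := fun v i _ =>
    (integrable_norm_sub_sq hp hsupp (w' i)).indicator (measurableSet_voronoi v i)
  unfold cost
  simp only [← fun v i => integral_indicator (μ := law p) (f := fun x => ‖w' i - x‖ ^ 2)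
    (measurableSet_voronoi v i)]
  rw [← integral_finsetSum _ (hint w'), ← integral_finsetSum _ (hint w)]
  refine mul_le_mul_of_nonneg_left (integral_mono_ae (integrable_finsetSum _ (hint w'))
    (integrable_finsetSum _ (hint w)) ?_) (by norm_num)
  filter_upwards [ae_forall_norm_sub_ne p hw'] with x hx
  obtain ⟨i, hi⟩ := exists_mem_voronoi w x
  obtain ⟨j, hj⟩ := exists_mem_voronoi w' x
  have hne : ∀ l ∈ Finset.univ, l ≠ j →
      (voronoi w' l).indicator (fun x => ‖w' l - x‖ ^ 2) x = 0 := fun l _ hl =>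
    indicator_of_notMem (fun h : x ∈ voronoi w' l => hx l j hl (le_antisymm (h j) (hj l))) _
  rw [Finset.sum_eq_single j hne (by simp), indicator_of_mem hj]
  calc ‖w' j - x‖ ^ 2 ≤ ‖w' i - x‖ ^ 2 := pow_le_pow_left₀ (norm_nonneg _) (hj i) 2
    _ = (voronoi w i).indicator (fun x => ‖w' i - x‖ ^ 2) x := by rw [indicator_of_mem hi]
    _ ≤ _ := Finset.single_le_sum (f := fun l =>
        (voronoi w l).indicator (fun x => ‖w' l - x‖ ^ 2) x)
        (fun l _ => indicator_nonneg (fun _ _ => by positivity) _) (Finset.mem_univ i)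

/-- The quadratic upper bound for the cost: it is obtained by moving the centers from `w` to
`w'` while keeping the cells of `w`. -/
lemma cost_le {w' : Centers k d} (hw' : w' ∈ nondegenerate k d) (w : Centers k d) :
    cost p w' ≤ cost p w + ∑ i, (inner ℝ (cellMoment p i w) (w' i - w i)
      + 1 / 2 * ‖w' i - w i‖ ^ 2) := by
  have := isProbabilityMeasure_law hp
  refine (cost_le_sum_setIntegral hp hsupp hw' w).trans ?_
  unfold cost
  rw [Finset.mul_sum, Finset.mul_sum, ← Finset.sum_add_distrib]
  refine Finset.sum_le_sum fun i _ => ?_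
  have hexp : ∀ x : Pt d, ‖w' i - x‖ ^ 2 = ‖w i - x‖ ^ 2
      + 2 * inner ℝ (w' i - w i) (w i - x) + ‖w' i - w i‖ ^ 2 := fun x => by
    have : w' i - x = (w i - x) + (w' i - w i) := by abel
    rw [this, norm_add_sq_real, real_inner_comm]
  have h1 := (integrable_norm_sub_sq hp hsupp (w i)).integrableOn (s := voronoi w i)
  have h2 := (integrable_sub hp hsupp (w i)).integrableOn (s := voronoi w i)
  have h3 : IntegrableOn (fun x => 2 * inner ℝ (w' i - w i) (w i - x)) (voronoi w i) (law p) :=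
    (h2.const_inner (w' i - w i)).const_mul 2
  rw [integral_congr_ae (.of_forall hexp), integral_add (by exact h1.add h3)
    (integrable_const _), integral_add h1 h3, integral_const_mul,
    integral_inner h2, setIntegral_const, real_inner_comm]
  change _ ≤ 1 / 2 * _ + (inner ℝ (cellMoment p i w) _ + _)
  have hm : (law p).real (voronoi w i) • ‖w' i - w i‖ ^ 2 ≤ ‖w' i - w i‖ ^ 2 := by
    rw [smul_eq_mul]
    exact mul_le_of_le_one_left (by positivity) measureReal_le_one
  unfold cellMoment
  linarith

/-- The cost is differentiable where the centers are distinct: the quadratic upper bounds at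
`w` and at `w'` sandwich the increment, and the cell moments are continuous. -/
lemma hasFDerivAt_cost {w : Centers k d} (hw : w ∈ nondegenerate k d) :
    HasFDerivAt (cost p) (∑ i, (innerSL ℝ (cellMoment p i w)).comp
      (ContinuousLinearMap.proj (R := ℝ) (φ := fun _ : Fin k => Pt d) i)) w := by
  rw [hasFDerivAt_iff_isLittleO, Asymptotics.isLittleO_iff]
  intro c hc
  set η := c / (k + 1) with hη
  have hη0 : 0 < η := by positivity
  have hcont : ∀ i : Fin k, ∀ᶠ w' in 𝓝 w, ‖cellMoment p i w' - cellMoment p i w‖ < η / 2 := by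
    intro i
    have := Metric.continuousAt_iff'.1 (continuousAt_cellMoment hp hsupp i hw) (η / 2)
      (by positivity)
    simpa only [dist_eq_norm] using this
  filter_upwards [eventually_all.2 hcont, isOpen_nondegenerate.mem_nhds hw,
    Metric.ball_mem_nhds w hη0] with w' h1 h2 h3
  rw [mem_ball_iff_norm] at h3
  have hup := cost_le hp hsupp h2 w
  have hdn := cost_le hp hsupp hw w'
  simp only [_root_.sum_apply, ContinuousLinearMap.comp_apply,
    ContinuousLinearMap.proj_apply, innerSL_apply_apply, Pi.sub_apply]
  have key : ∀ i, |inner ℝ (cellMoment p i w' - cellMoment p i w) (w' i - w i)|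
      ≤ η / 2 * ‖w' - w‖ := fun i =>
    (abs_real_inner_le_norm _ _).trans
      (mul_le_mul (h1 i).le (norm_le_pi_norm (w' - w) i) (norm_nonneg _) (by positivity))
  have key2 : ∀ i, 1 / 2 * ‖w' i - w i‖ ^ 2 ≤ η / 2 * ‖w' - w‖ := fun i => by
    have := norm_le_pi_norm (w' - w) i
    rw [Pi.sub_apply] at this
    nlinarith [norm_nonneg (w' i - w i)]
  have e1 : ∑ i, (inner ℝ (cellMoment p i w) (w' i - w i) + 1 / 2 * ‖w' i - w i‖ ^ 2)
      ≤ ∑ i, inner ℝ (cellMoment p i w) (w' i - w i) + k * (η * ‖w' - w‖) := by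
    rw [Finset.sum_add_distrib]
    gcongr
    calc _ ≤ ∑ _i : Fin k, η * ‖w' - w‖ := Finset.sum_le_sum fun i _ =>
          (key2 i).trans (by have := mul_nonneg hη0.le (norm_nonneg (w' - w)); linarith)
      _ = _ := by simp
  have e2 : ∑ i, (inner ℝ (cellMoment p i w') (w i - w' i) + 1 / 2 * ‖w i - w' i‖ ^ 2)
      ≤ -∑ i, inner ℝ (cellMoment p i w) (w' i - w i) + k * (η * ‖w' - w‖) := by
    rw [← Finset.sum_neg_distrib]
    calc _ ≤ ∑ i : Fin k, (-inner ℝ (cellMoment p i w) (w' i - w i) + η * ‖w' - w‖) := by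
          refine Finset.sum_le_sum fun i _ => ?_
          have a := (abs_le.1 (key i)).1
          have b := key2 i
          rw [norm_sub_rev, ← neg_sub (w' i), inner_neg_right]
          rw [inner_sub_left] at a
          linarith
      _ = _ := by simp [Finset.sum_add_distrib]
  have e3 : (k : ℝ) * (η * ‖w' - w‖) ≤ c * ‖w' - w‖ := by
    rw [← mul_assoc]
    gcongr
    rw [hη, mul_div_assoc', div_le_iff₀ (by positivity)]
    nlinarith
  rw [Real.norm_eq_abs, abs_le]
  constructor <;> linarith

lemma gradCost_eq_cellMoment (i : Fin k) {w : Centers k d} (hw : w ∈ nondegenerate k d) :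
    gradCost p i w = cellMoment p i w := by
  have h := hasFDerivAt_cost hp hsupp hw
  have h2 := HasFDerivAt.comp (g := cost p) (w i) (by rwa [Function.update_eq_self])
    (hasFDerivAt_update (𝕜 := ℝ) w (w i))
  refine HasGradientAt.gradient ?_
  rw [hasGradientAt_iff_hasFDerivAt]
  refine h2.congr_fderiv ?_
  ext y
  simp only [_root_.sum_apply, ContinuousLinearMap.comp_apply,
    ContinuousLinearMap.proj_apply, innerSL_apply_apply, InnerProductSpace.toDual_apply_apply]
  rw [Finset.sum_eq_single i]
  · simp
  · intro j _ hj
    simp [hj]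
  · simp

lemma mem_stationary {w : Centers k d} (hw : w ∈ nondegenerate k d)
    (h : ∀ i, cellMoment p i w = 0) : w ∈ stationary (cost (k := k) p) := by
  refine (hasFDerivAt_cost hp hsupp hw).congr_fderiv ?_
  simp [h]

omit hsupp in
lemma measurable_cost : Measurable (cost (k := k) p) := by
  have := isProbabilityMeasure_law hp
  have h : cost (k := k) p = fun w => (1 / 2 : ℝ) * ∑ i, ∫ x,
      {q : Centers k d × Pt d | q.2 ∈ voronoi q.1 i}.indicator
        (fun q => ‖q.1 i - q.2‖ ^ 2) (w, x) ∂law p := by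
    funext w
    unfold cost
    simp only [← integral_indicator (measurableSet_voronoi w _)]
    rfl
  rw [h]
  refine (Finset.measurable_sum _ fun i _ => ?_).const_mul _
  refine StronglyMeasurable.measurable (StronglyMeasurable.integral_prod_right
    (f := fun q => _) (Measurable.stronglyMeasurable ?_))
  exact Measurable.indicator (by fun_prop) (measurableSet_mem_voronoi i)

omit hsupp in
lemma measurable_cellMoment (i : Fin k) : Measurable (cellMoment p i : Centers k d → Pt d) := by
  have := isProbabilityMeasure_law hp
  have h : (cellMoment p i : Centers k d → Pt d) = fun w => ∫ x,
      {q : Centers k d × Pt d | q.2 ∈ voronoi q.1 i}.indicator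
        (fun q => q.1 i - q.2) (w, x) ∂law p := by
    funext w
    rw [cellMoment_eq_indicator]
    rfl
  rw [h]
  refine StronglyMeasurable.measurable (StronglyMeasurable.integral_prod_right
    (f := fun q => _) (Measurable.stronglyMeasurable ?_))
  exact Measurable.indicator (by fun_prop) (measurableSet_mem_voronoi i)

omit hsupp in
lemma measurable_mass (i : Fin k) : Measurable fun w : Centers k d => mass p w i := by
  have := isProbabilityMeasure_law hp
  exact (measurable_measure_prodMk_left (measurableSet_mem_voronoi i)).ennreal_toReal

omit hp hsupp in
lemma cost_nonneg (w : Centers k d) : 0 ≤ cost p w :=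
  mul_nonneg (by norm_num) (Finset.sum_nonneg fun i _ =>
    integral_nonneg fun x => by positivity)

lemma cost_le_of_mem {w : Centers k d} (hw : w ∈ nondegenerateIn k d R) :
    cost p w ≤ k * (2 * R) ^ 2 := by
  have := isProbabilityMeasure_law hp
  have h : ∀ i, ∫ x in voronoi w i, ‖w i - x‖ ^ 2 ∂law p ≤ (2 * R) ^ 2 := by
    intro i
    refine (Real.le_norm_self _).trans ((norm_setIntegral_le_of_norm_le_const_ae
      (C := (2 * R) ^ 2) (measure_lt_top _ _) ?_).trans
      (mul_le_of_le_one_right (by positivity) measureReal_le_one))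
    filter_upwards [ae_restrict_of_ae (ae_norm_le hsupp)] with x hx
    rw [norm_pow, norm_norm]
    refine pow_le_pow_left₀ (norm_nonneg _) ((norm_sub_le _ _).trans ?_) 2
    linarith [hw.2 i]
  have h2 : ∑ i, ∫ x in voronoi w i, ‖w i - x‖ ^ 2 ∂law p ≤ k * (2 * R) ^ 2 :=
    (Finset.sum_le_sum fun i _ => h i).trans (by simp)
  have h3 : 0 ≤ (k : ℝ) * (2 * R) ^ 2 := by positivity
  unfold cost
  linarith

end Cells

section Sampling

variable {Ω : Type*} {k d : ℕ} {p : Pt d → ℝ} {R : ℝ}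

/-! ### The natural filtration -/

lemma measurable_update_step {m : MeasurableSpace Ω} {w x : Ω → Centers k d}
    {h : Ω → Fin k → ℝ} (hw : Measurable w) (hx : Measurable x) (hh : Measurable h) :
    Measurable fun ω i => w ω i - h ω i • (w ω i - x ω i) := by
  fun_prop

lemma measurable_history_sample (W X : ℕ → Ω → Centers k d) (H : ℕ → Ω → Fin k → ℝ) (n : ℕ) :
    Measurable[history W X H (n + 1)] (X (n + 1)) :=
  (comap_measurable (X (n + 1))).mono (le_sup_right.trans le_sup_left) le_rfl

lemma measurable_history_rate (W X : ℕ → Ω → Centers k d) (H : ℕ → Ω → Fin k → ℝ) (n : ℕ) :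
    Measurable[history W X H (n + 1)] (H (n + 1)) :=
  (comap_measurable (H (n + 1))).mono le_sup_right le_rfl

lemma history_le_succ (W X : ℕ → Ω → Centers k d) (H : ℕ → Ω → Fin k → ℝ) (n : ℕ) :
    history W X H n ≤ history W X H (n + 1) :=
  le_sup_left.trans le_sup_left

variable [mΩ : MeasurableSpace Ω] {μ : Measure Ω}
  {W X : ℕ → Ω → Centers k d} {H : ℕ → Ω → Fin k → ℝ}

lemma IsOnlineKMeans.history_le (halg : IsOnlineKMeans μ p W X H) (n : ℕ) :
    history W X H n ≤ mΩ := by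
  induction n with
  | zero => exact halg.measurable_init.comap_le
  | succ n ih =>
    exact sup_le (sup_le ih (halg.measurable_sample n).comap_le) (halg.measurable_rate n).comap_le

/-- The natural filtration of the algorithm, bundled. -/
noncomputable def IsOnlineKMeans.filtration (halg : IsOnlineKMeans μ p W X H) : Filtration ℕ mΩ where
  seq := history W X H
  mono' := monotone_nat_of_le_succ (history_le_succ W X H)
  le' := halg.history_le

lemma IsOnlineKMeans.measurable_centers (halg : IsOnlineKMeans μ p W X H) (n : ℕ) :
    Measurable[history W X H n] (W n) := by
  induction n with
  | zero => exact comap_measurable (W 0)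
  | succ n ih =>
    have h : W (n + 1) = fun ω i => W n ω i - H (n + 1) ω i • (W n ω i - X (n + 1) ω i) := by
      funext ω i; exact halg.update n ω i
    rw [h]
    exact measurable_update_step (ih.mono (history_le_succ W X H n) le_rfl)
      (measurable_history_sample W X H n) (measurable_history_rate W X H n)

lemma IsOnlineKMeans.measurable_centers' (halg : IsOnlineKMeans μ p W X H) (n : ℕ) :
    Measurable (W n) :=
  (halg.measurable_centers n).mono (halg.history_le n) le_rfl

/-! ### The joint law of centers, rates and samples -/

/-- The law of the data conditioned on the `i`-th cell, as a kernel in the centers. It is a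
probability measure where the cell has positive mass, and zero elsewhere. -/
noncomputable def cellKernel (hp : IsDensity p) (i : Fin k) : Kernel (Centers k d) (Pt d) where
  toFun w := (law p)[|voronoi w i]
  measurable' := by
    have := isProbabilityMeasure_law hp
    refine Measure.measurable_of_measurable_coe _ fun S hS => ?_
    simp only [cond_apply (measurableSet_voronoi _ _)]
    refine (measurable_measure_prodMk_left (measurableSet_mem_voronoi i)).inv.mul ?_
    exact measurable_measure_prodMk_left
      ((measurableSet_mem_voronoi i).inter (measurable_snd hS))

lemma cellKernel_apply (hp : IsDensity p) (i : Fin k) (w : Centers k d) :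
    cellKernel hp i w = (law p)[|voronoi w i] := rfl

instance (hp : IsDensity p) (i : Fin k) : IsFiniteKernel (cellKernel (d := d) hp i) :=
  ⟨1, ENNReal.one_lt_top, fun w => by rw [cellKernel_apply]; exact prob_le_one⟩

lemma integral_cellKernel_sub (hp : IsDensity p) (i : Fin k) (w : Centers k d) :
    ∫ x, (w i - x) ∂cellKernel hp i w = (mass p w i)⁻¹ • cellMoment p i w := by
  rw [cellKernel_apply, ProbabilityTheory.cond, integral_smul_measure, ENNReal.toReal_inv]
  rfl

section Rates

variable [IsProbabilityMeasure μ] (hp : IsDensity p) (halg : IsOnlineKMeans μ p W X H)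
  (hrate : RateAssumptions μ p W X H)

include halg

omit [IsProbabilityMeasure μ] in
include hp in
lemma measurableSet_mass_pos (n : ℕ) (i : Fin k) :
    MeasurableSet[history W X H n] {ω | 0 < mass p (W n ω) i} :=
  halg.measurable_centers n (measurableSet_lt measurable_const (measurable_mass hp i))

include hrate

/-- Conditional independence of rates and samples says that the `i`-th sample is drawn from its
cell given the past *and* the rates of the step. -/
lemma measureReal_inter_rate_sample (n : ℕ) (i : Fin k) {D : Set Ω}
    (hD : MeasurableSet[history W X H n] D) (hDm : D ⊆ {ω | 0 < mass p (W n ω) i})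
    {B : Set (Fin k → ℝ)} (hB : MeasurableSet B) {S : Set (Pt d)} (hS : MeasurableSet S) :
    μ.real (D ∩ (H (n + 1) ⁻¹' B ∩ (fun ω => X (n + 1) ω i) ⁻¹' S)) =
      ∫ ω in D ∩ H (n + 1) ⁻¹' B, (cellKernel hp i (W n ω)).real S ∂μ := by
  have hle := halg.history_le n
  have hHB := halg.measurable_rate n hB
  have hSi : MeasurableSet {x : Centers k d | x i ∈ S} := measurable_pi_apply i hS
  have hXS : MeasurableSet ((fun ω => X (n + 1) ω i) ⁻¹' S) := halg.measurable_sample n hSi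
  have hci := hrate.condIndep n B {x : Centers k d | x i ∈ S} hB hSi
  change μ⟦H (n + 1) ⁻¹' B ∩ (fun ω => X (n + 1) ω i) ⁻¹' S | history W X H n⟧ =ᵐ[μ] fun ω =>
    (μ⟦H (n + 1) ⁻¹' B | history W X H n⟧) ω *
      (μ⟦(fun ω => X (n + 1) ω i) ⁻¹' S | history W X H n⟧) ω at hci
  set K : Ω → ℝ := fun ω => (cellKernel hp i (W n ω)).real S with hK
  have hKm : Measurable[history W X H n] K :=
    ((Kernel.measurable_coe (cellKernel hp i) hS).comp (halg.measurable_centers n)).ennreal_toReal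
  have hKb : ∀ᵐ ω ∂μ, ‖K ω‖ ≤ 1 := .of_forall fun ω => by
    rw [Real.norm_of_nonneg measureReal_nonneg]
    simp only [cellKernel_apply]
    exact measureReal_le_one
  have hind : ∀ {E : Set Ω}, MeasurableSet E → Integrable (E.indicator fun _ => (1 : ℝ)) μ :=
    fun hE => (integrable_const _).indicator hE
  -- the cell kernel is known at time `n`, so it may be moved inside the conditional expectation
  have hpull := condExp_stronglyMeasurable_mul_of_bound hle hKm.stronglyMeasurable (hind hHB) 1 hKb
  have hprod : Integrable (K * (H (n + 1) ⁻¹' B).indicator fun _ => (1 : ℝ)) μ :=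
    (hind hHB).bdd_mul (hKm.mono hle le_rfl).aestronglyMeasurable hKb
  calc μ.real (D ∩ (H (n + 1) ⁻¹' B ∩ (fun ω => X (n + 1) ω i) ⁻¹' S))
      = ∫ ω in D, (H (n + 1) ⁻¹' B ∩ (fun ω => X (n + 1) ω i) ⁻¹' S).indicator
          (fun _ => (1 : ℝ)) ω ∂μ := by
        rw [integral_indicator_const _ (hHB.inter hXS), smul_eq_mul, mul_one,
          measureReal_restrict_apply (hHB.inter hXS), inter_comm]
    _ = ∫ ω in D, (μ⟦H (n + 1) ⁻¹' B ∩ (fun ω => X (n + 1) ω i) ⁻¹' S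
          | history W X H n⟧) ω ∂μ := (setIntegral_condExp hle (hind (hHB.inter hXS)) hD).symm
    _ = ∫ ω in D, (μ[K * (H (n + 1) ⁻¹' B).indicator fun _ => (1 : ℝ) | history W X H n]) ω ∂μ := by
        refine setIntegral_congr_ae (hle _ hD) ?_
        filter_upwards [hci, halg.sample n i S hS, hpull] with ω h1 h2 h3 hω
        rw [h1, h2 (hDm hω), h3, mul_comm]
        rfl
    _ = ∫ ω in D, (K * (H (n + 1) ⁻¹' B).indicator fun _ => (1 : ℝ)) ω ∂μ :=
        setIntegral_condExp hle hprod hD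
    _ = ∫ ω in D, (H (n + 1) ⁻¹' B).indicator K ω ∂μ := by
        refine integral_congr_ae (.of_forall fun ω => ?_)
        by_cases h : ω ∈ H (n + 1) ⁻¹' B <;> simp [h]
    _ = ∫ ω in D ∩ H (n + 1) ⁻¹' B, K ω ∂μ := setIntegral_indicator hHB

/-- On an event of the past where the `i`-th cell has positive mass, the joint law of centers,
rates and `i`-th sample is the law of centers and rates composed with the cell kernel. -/
lemma map_centers_rate_sample (n : ℕ) (i : Fin k) {A : Set Ω}
    (hA : MeasurableSet[history W X H n] A) (hAm : A ⊆ {ω | 0 < mass p (W n ω) i}) :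
    (μ.restrict A).map (fun ω => ((W n ω, H (n + 1) ω), X (n + 1) ω i)) =
      (μ.restrict A).map (fun ω => (W n ω, H (n + 1) ω)) ⊗ₘ
        (cellKernel hp i).prodMkRight (Fin k → ℝ) := by
  have hW := halg.measurable_centers' n
  have hH := halg.measurable_rate n
  have hX : Measurable fun ω => X (n + 1) ω i := (measurable_pi_apply i).comp
    (halg.measurable_sample n)
  refine Measure.ext_prod₃_iff'.2 fun {C B S} hC hB hS => ?_
  have hD : MeasurableSet[history W X H n] (A ∩ W n ⁻¹' C) :=
    hA.inter (halg.measurable_centers n hC)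
  have hm := halg.history_le n _ hA
  have hkey := measureReal_inter_rate_sample hp halg hrate n i hD
    (inter_subset_left.trans hAm) hB hS
  rw [Measure.map_apply (by fun_prop) ((hC.prod hB).prod hS),
    Measure.compProd_apply_prod (hC.prod hB) hS,
    setLIntegral_map (hC.prod hB) (Kernel.measurable_coe _ hS) (by fun_prop),
    Measure.restrict_apply (((hW.prodMk hH).prodMk hX) ((hC.prod hB).prod hS)),
    Measure.restrict_restrict ((hW.prodMk hH) (hC.prod hB))]
  have e1 : (fun ω => ((W n ω, H (n + 1) ω), X (n + 1) ω i)) ⁻¹' ((C ×ˢ B) ×ˢ S) ∩ A =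
      A ∩ W n ⁻¹' C ∩ (H (n + 1) ⁻¹' B ∩ (fun ω => X (n + 1) ω i) ⁻¹' S) := by
    ext ω; simp; tauto
  have e2 : (fun ω => (W n ω, H (n + 1) ω)) ⁻¹' (C ×ˢ B) ∩ A =
      A ∩ W n ⁻¹' C ∩ H (n + 1) ⁻¹' B := by
    ext ω; simp; tauto
  simp only [Kernel.prodMkRight_apply]
  rw [e1, e2, ← ofReal_measureReal, hkey, ofReal_integral_eq_lintegral_ofReal]
  · refine lintegral_congr fun ω => ?_
    rw [ofReal_measureReal]
  · refine Integrable.of_bound (((Kernel.measurable_coe (cellKernel hp i) hS).comp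
      hW).ennreal_toReal.aestronglyMeasurable) 1 (.of_forall fun ω => ?_)
    rw [Real.norm_of_nonneg measureReal_nonneg, cellKernel_apply]
    exact measureReal_le_one
  · exact .of_forall fun ω => measureReal_nonneg

end Rates

end Sampling

/-! ### The centers stay distinct -/

/-- A point moved from `a` towards `x` stays strictly closer to `a` than to `b ≠ a`, if `x` is. -/
lemma norm_sub_lt_norm_sub_of_step {E : Type*} [NormedAddCommGroup E] [InnerProductSpace ℝ E]
    {a b x : E} {h : ℝ} (hab : a ≠ b) (h0 : 0 ≤ h) (h1 : h ≤ 1)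
    (hx : h = 0 ∨ ‖a - x‖ < ‖b - x‖) :
    ‖a - (a - h • (a - x))‖ < ‖b - (a - h • (a - x))‖ := by
  rcases hx with rfl | hx
  · simpa [sub_eq_zero] using hab.symm
  have hv : 0 < ‖b - a‖ ^ 2 := by
    have := norm_pos_iff.2 (sub_ne_zero.2 hab.symm)
    positivity
  have e1 : a - (a - h • (a - x)) = h • (a - x) := by abel
  have e2 : b - (a - h • (a - x)) = (b - a) + h • (a - x) := by abel
  have e3 : b - x = (b - a) + (a - x) := by abel
  rw [e3, ← sq_lt_sq₀ (norm_nonneg _) (norm_nonneg _), norm_add_sq_real] at hx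
  rw [e1, e2, ← sq_lt_sq₀ (norm_nonneg _) (norm_nonneg _), norm_add_sq_real, inner_smul_right]
  rcases h0.eq_or_lt with rfl | h0
  · linarith
  · have h2 : 0 ≤ (1 - h) * ‖b - a‖ ^ 2 := mul_nonneg (by linarith) hv.le
    have h3 : 0 < h * (‖b - a‖ ^ 2 + 2 * inner ℝ (b - a) (a - x)) := mul_pos h0 (by linarith)
    linarith

lemma step_mem_nondegenerateIn {k d : ℕ} {R : ℝ} {w x w' : Centers k d} {h : Fin k → ℝ}
    (hw : w ∈ nondegenerateIn k d R) (hh : ∀ i, 0 ≤ h i ∧ h i ≤ 1)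
    (hw' : ∀ i, w' i = w i - h i • (w i - x i))
    (hx : ∀ i, h i = 0 ∨ ‖x i‖ ≤ R ∧ ∀ j, j ≠ i → ‖w i - x i‖ < ‖w j - x i‖) :
    w' ∈ nondegenerateIn k d R := by
  have key : ∀ i j, j ≠ i → ‖w i - w' i‖ < ‖w j - w' i‖ := by
    intro i j hj
    rw [hw' i]
    exact norm_sub_lt_norm_sub_of_step (hw.1 i j hj.symm) (hh i).1 (hh i).2
      ((hx i).imp_right fun h => h.2 j hj)
  refine ⟨fun i j hij h => ?_, fun i => ?_⟩
  · have h1 := key i j hij.symm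
    have h2 := key j i hij
    rw [← h] at h2
    exact lt_asymm h1 h2
  · rw [hw' i]
    rcases hx i with h0 | h0
    · simpa [h0] using hw.2 i
    · have e : w i - h i • (w i - x i) = (1 - h i) • w i + h i • x i := by module
      rw [e]
      refine (norm_add_le _ _).trans ?_
      rw [norm_smul, norm_smul, Real.norm_of_nonneg (hh i).1,
        Real.norm_of_nonneg (sub_nonneg.2 (hh i).2)]
      have h1 := mul_le_mul_of_nonneg_left (hw.2 i) (sub_nonneg.2 (hh i).2)
      have h2 := mul_le_mul_of_nonneg_left h0.1 (hh i).1
      linarith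

section Run

variable {Ω : Type*} {k d : ℕ} {p : Pt d → ℝ} {R : ℝ} [mΩ : MeasurableSpace Ω] {μ : Measure Ω}
  {W X : ℕ → Ω → Centers k d} {H : ℕ → Ω → Fin k → ℝ} [IsProbabilityMeasure μ]
  (hp : IsDensity p) (hsupp : law p {x | R < ‖x‖} = 0) (halg : IsOnlineKMeans μ p W X H)
  (hrate : RateAssumptions μ p W X H)

include hp hsupp halg hrate

/-- Almost surely the sample of a cell of positive mass lies in the ball and in the interior of
its cell. -/
lemma ae_sample_mem (n : ℕ) (i : Fin k) :
    ∀ᵐ ω ∂μ, 0 < mass p (W n ω) i → W n ω ∈ nondegenerate k d →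
      ‖X (n + 1) ω i‖ ≤ R ∧
        ∀ j, j ≠ i → ‖W n ω i - X (n + 1) ω i‖ < ‖W n ω j - X (n + 1) ω i‖ := by
  have hA := measurableSet_mass_pos hp halg n i
  have hW := halg.measurable_centers' n
  have hH := halg.measurable_rate n
  have hX : Measurable fun ω => X (n + 1) ω i := (measurable_pi_apply i).comp
    (halg.measurable_sample n)
  have hmap := map_centers_rate_sample hp halg hrate n i hA Subset.rfl
  let q : (Centers k d × (Fin k → ℝ)) × Pt d → Prop := fun z =>
    z.1.1 ∈ nondegenerate k d → ‖z.2‖ ≤ R ∧ ∀ j, j ≠ i → ‖z.1.1 i - z.2‖ < ‖z.1.1 j - z.2‖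
  have hq : MeasurableSet {z | q z} := by
    have : {z | q z} = {z | z.1.1 ∈ nondegenerate k d}ᶜ ∪
        ({z | ‖z.2‖ ≤ R} ∩ ⋂ j, ⋂ _ : j ≠ i, {z | ‖z.1.1 i - z.2‖ < ‖z.1.1 j - z.2‖}) := by
      ext z; simp [q, imp_iff_not_or]
    rw [this]
    refine MeasurableSet.union (MeasurableSet.compl ?_) (MeasurableSet.inter ?_ ?_)
    · exact (measurable_fst.comp measurable_fst) isOpen_nondegenerate.measurableSet
    · exact measurableSet_le (by fun_prop) (by fun_prop)
    · exact MeasurableSet.iInter fun j => MeasurableSet.iInter fun _ =>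
        measurableSet_lt (by fun_prop) (by fun_prop)
  have hae : ∀ᵐ z ∂((μ.restrict {ω | 0 < mass p (W n ω) i}).map
      (fun ω => ((W n ω, H (n + 1) ω), X (n + 1) ω i))), q z := by
    rw [hmap]
    refine Measure.ae_compProd_of_ae_ae hq (.of_forall fun z => ?_)
    rw [Kernel.prodMkRight_apply, cellKernel_apply]
    refine Measure.ae_smul_measure ?_ _
    rw [ae_restrict_iff' (measurableSet_voronoi _ _)]
    by_cases hz : z.1 ∈ nondegenerate k d
    · filter_upwards [ae_norm_le hsupp, ae_forall_norm_sub_ne p hz] with x h1 h2 hx _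
      exact ⟨h1, fun j hj => lt_of_le_of_ne (hx j) (h2 i j hj.symm)⟩
    · exact .of_forall fun x _ h => absurd h hz
  have h2 := ae_of_ae_map (by fun_prop) hae
  rw [ae_restrict_iff' (halg.history_le n _ hA)] at h2
  exact h2

/-- Almost surely each center either does not move, or moves towards a point of the ball in
the interior of its cell. -/
lemma ae_rate_eq_zero_or (n : ℕ) :
    ∀ᵐ ω ∂μ, W n ω ∈ nondegenerate k d → ∀ i, H (n + 1) ω i = 0 ∨ (‖X (n + 1) ω i‖ ≤ R ∧
      ∀ j, j ≠ i → ‖W n ω i - X (n + 1) ω i‖ < ‖W n ω j - X (n + 1) ω i‖) := by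
  filter_upwards [ae_all_iff.2 (ae_sample_mem hp hsupp halg hrate n),
    ae_all_iff.2 (hrate.zero_of_mass_zero n)] with ω h1 h2 hω i
  rcases (mass_nonneg p (W n ω) i).eq_or_lt with h | h
  · exact Or.inl (h2 i h.symm)
  · exact Or.inr (h1 i h hω)

lemma ae_mem_nondegenerateIn : ∀ᵐ ω ∂μ, ∀ n, W n ω ∈ nondegenerateIn k d R := by
  refine ae_all_iff.2 fun n => ?_
  induction n with
  | zero =>
    filter_upwards [halg.init_distinct, halg.init_support] with ω h1 h2
    refine ⟨h1, fun i => ?_⟩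
    have hcl : IsClosed {x : Pt d | ‖x‖ ≤ R} := isClosed_le continuous_norm continuous_const
    exact Measure.support_subset_of_isClosed hcl (ae_norm_le hsupp) (h2 i)
  | succ n ih =>
    filter_upwards [ih, ae_rate_eq_zero_or hp hsupp halg hrate n,
      ae_all_iff.2 (hrate.mem_Icc n)] with ω h1 h2 h3
    exact step_mem_nondegenerateIn h1 h3 (halg.update n ω) (h2 h1.1)

lemma ae_rate_mul_norm_le :
    ∀ᵐ ω ∂μ, ∀ n i, H (n + 1) ω i * ‖W n ω i - X (n + 1) ω i‖ ≤ H (n + 1) ω i * (2 * R) := by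
  filter_upwards [ae_mem_nondegenerateIn hp hsupp halg hrate,
    ae_all_iff.2 (ae_rate_eq_zero_or hp hsupp halg hrate),
    ae_all_iff.2 fun n => ae_all_iff.2 (hrate.mem_Icc n)] with ω h1 h2 h3 n i
  rcases h2 n (h1 n).1 i with h | h
  · simp [h]
  · refine mul_le_mul_of_nonneg_left ((norm_sub_le _ _).trans ?_) (h3 n i).1
    linarith [(h1 n).2 i, h.1]

/-! ### Expected decrease of the cost -/

lemma integrable_rate_mul_sq (n : ℕ) (i : Fin k) :
    Integrable (fun ω => H (n + 1) ω i * ‖cellMoment p i (W n ω)‖ ^ 2) μ := by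
  have hH : Measurable fun ω => H (n + 1) ω i :=
    (measurable_pi_apply i).comp (halg.measurable_rate n)
  have hg := (measurable_cellMoment hp i).comp (halg.measurable_centers' n)
  refine Integrable.of_bound (hH.mul (hg.norm.pow_const 2)).aestronglyMeasurable
    ((R + |R|) ^ 2) ?_
  filter_upwards [ae_mem_nondegenerateIn hp hsupp halg hrate, hrate.mem_Icc n i] with ω h1 h2
  rw [Real.norm_of_nonneg (mul_nonneg h2.1 (by positivity))]
  refine (mul_le_of_le_one_left (by positivity) h2.2).trans ?_
  refine pow_le_pow_left₀ (norm_nonneg _) ?_ 2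
  exact (norm_cellMoment_le hp hsupp _ i).trans (by gcongr; exact (h1 n).2 i)

lemma integrable_rate_mul_inner (n : ℕ) (i : Fin k) :
    Integrable (fun ω => H (n + 1) ω i *
      inner ℝ (cellMoment p i (W n ω)) (W n ω i - X (n + 1) ω i)) μ := by
  have hH : Measurable fun ω => H (n + 1) ω i :=
    (measurable_pi_apply i).comp (halg.measurable_rate n)
  have hX : Measurable fun ω => X (n + 1) ω i := (measurable_pi_apply i).comp
    (halg.measurable_sample n)
  have hW : Measurable fun ω => W n ω i := (measurable_pi_apply i).comp
    (halg.measurable_centers' n)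
  have hg := (measurable_cellMoment hp i).comp (halg.measurable_centers' n)
  refine Integrable.of_bound (hH.mul (hg.inner (hW.sub hX))).aestronglyMeasurable
    ((R + |R|) * (1 * (2 * |R|))) ?_
  filter_upwards [ae_mem_nondegenerateIn hp hsupp halg hrate, hrate.mem_Icc n i,
    ae_rate_mul_norm_le hp hsupp halg hrate] with ω h1 h2 h3
  rw [norm_mul, Real.norm_of_nonneg h2.1]
  have hR : 0 ≤ R := (norm_nonneg _).trans ((h1 n).2 i)
  calc H (n + 1) ω i * ‖inner ℝ (cellMoment p i (W n ω)) (W n ω i - X (n + 1) ω i)‖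
      ≤ H (n + 1) ω i * (‖cellMoment p i (W n ω)‖ * ‖W n ω i - X (n + 1) ω i‖) :=
        mul_le_mul_of_nonneg_left (norm_inner_le_norm _ _) h2.1
    _ = ‖cellMoment p i (W n ω)‖ * (H (n + 1) ω i * ‖W n ω i - X (n + 1) ω i‖) := by ring
    _ ≤ (R + |R|) * (1 * (2 * |R|)) := by
        refine mul_le_mul ?_ ((h3 n i).trans ?_) (mul_nonneg h2.1 (norm_nonneg _)) (by positivity)
        · exact (norm_cellMoment_le hp hsupp _ i).trans (by gcongr; exact (h1 n).2 i)
        · exact mul_le_mul h2.2 (by gcongr; exact le_abs_self R) (by positivity) (by norm_num)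

/-- Given the past and the rates, the mean displacement `w_i - X_i` is the partial gradient
divided by the mass of the cell, and the mass is at most one. -/
lemma setIntegral_rate_mul_sq_le (n : ℕ) (i : Fin k) {A : Set Ω}
    (hA : MeasurableSet[history W X H n] A) :
    ∫ ω in A, H (n + 1) ω i * ‖cellMoment p i (W n ω)‖ ^ 2 ∂μ ≤
      ∫ ω in A, H (n + 1) ω i *
        inner ℝ (cellMoment p i (W n ω)) (W n ω i - X (n + 1) ω i) ∂μ := by
  set P : Set Ω := {ω | 0 < mass p (W n ω) i} with hP
  have hPm := measurableSet_mass_pos hp halg n i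
  have hW := halg.measurable_centers' n
  have hH := halg.measurable_rate n
  have hX : Measurable fun ω => X (n + 1) ω i := (measurable_pi_apply i).comp
    (halg.measurable_sample n)
  -- outside `P` the center does not move, so both integrands vanish there
  have hred : ∀ F : Ω → ℝ, ∫ ω in A, H (n + 1) ω i * F ω ∂μ =
      ∫ ω in A ∩ P, H (n + 1) ω i * F ω ∂μ := by
    intro F
    refine setIntegral_eq_of_subset_of_ae_sdiff_eq_zero (f := fun ω => H (n + 1) ω i * F ω)
      (halg.history_le n _ hA).nullMeasurableSet inter_subset_left ?_
    filter_upwards [hrate.zero_of_mass_zero n i] with ω h0 hω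
    have : mass p (W n ω) i = 0 :=
      le_antisymm (not_lt.1 fun h => hω.2 ⟨hω.1, h⟩) (mass_nonneg p _ i)
    rw [h0 this, zero_mul]
  rw [hred, hred]
  have hmap := map_centers_rate_sample hp halg hrate n i (hA.inter hPm) inter_subset_right
  set ν := μ.restrict (A ∩ P) with hν
  let T : Ω → Centers k d × (Fin k → ℝ) := fun ω => (W n ω, H (n + 1) ω)
  let φ : (Centers k d × (Fin k → ℝ)) × Pt d → ℝ := fun z =>
    z.1.2 i * inner ℝ (cellMoment p i z.1.1) (z.1.1 i - z.2)
  have hT : Measurable T := hW.prodMk hH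
  have hgm := measurable_cellMoment hp (k := k) i
  have hφ : Measurable φ := by
    have h1 : Measurable fun z : (Centers k d × (Fin k → ℝ)) × Pt d =>
      cellMoment p i z.1.1 := hgm.comp (measurable_fst.comp measurable_fst)
    have h2 : Measurable fun z : (Centers k d × (Fin k → ℝ)) × Pt d => z.1.1 i - z.2 := by
      fun_prop
    have h3 : Measurable fun z : (Centers k d × (Fin k → ℝ)) × Pt d => z.1.2 i := by fun_prop
    exact h3.mul (h1.inner h2)
  have hφint : Integrable φ (ν.map fun ω => (T ω, X (n + 1) ω i)) := by
    rw [integrable_map_measure hφ.aestronglyMeasurable (by fun_prop)]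
    exact (integrable_rate_mul_inner hp hsupp halg hrate n i).integrableOn
  have hinner : ∀ z : Centers k d × (Fin k → ℝ),
      ∫ x, φ (z, x) ∂((cellKernel hp i).prodMkRight (Fin k → ℝ) z) =
        z.2 i * ((mass p z.1 i)⁻¹ * ‖cellMoment p i z.1‖ ^ 2) := by
    intro z
    have hi : Integrable (fun x => z.1 i - x) (cellKernel hp i z.1) := by
      rw [cellKernel_apply]
      by_cases h0 : law p (voronoi z.1 i) = 0
      · rw [cond_eq_zero_of_meas_eq_zero h0]; exact integrable_zero_measure
      · exact (integrable_sub hp hsupp _).integrableOn.smul_measure (ENNReal.inv_ne_top.2 h0)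
    simp only [φ, Kernel.prodMkRight_apply]
    rw [integral_const_mul, integral_inner hi, integral_cellKernel_sub, inner_smul_right,
      real_inner_self_eq_norm_sq]
  have hL : ∫ ω in A ∩ P, H (n + 1) ω i * inner ℝ (cellMoment p i (W n ω))
      (W n ω i - X (n + 1) ω i) ∂μ =
      ∫ ω, H (n + 1) ω i * ((mass p (W n ω) i)⁻¹ * ‖cellMoment p i (W n ω)‖ ^ 2) ∂ν := by
    calc _ = ∫ z, φ z ∂(ν.map fun ω => (T ω, X (n + 1) ω i)) :=
          (integral_map (by fun_prop) hφ.aestronglyMeasurable).symm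
      _ = ∫ z, z.2 i * ((mass p z.1 i)⁻¹ * ‖cellMoment p i z.1‖ ^ 2) ∂(ν.map T) := by
          rw [hmap] at hφint ⊢
          rw [Measure.integral_compProd hφint]
          exact integral_congr_ae (.of_forall hinner)
      _ = _ := by
          rw [integral_map hT.aemeasurable]
          refine Measurable.aestronglyMeasurable ?_
          have h3 : Measurable fun z : Centers k d × (Fin k → ℝ) => z.2 i := by fun_prop
          exact h3.mul (((measurable_mass hp i).comp measurable_fst).inv.mul
            ((hgm.comp measurable_fst).norm.pow_const 2))
  have hLint : Integrable (fun ω => H (n + 1) ω i *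
      ((mass p (W n ω) i)⁻¹ * ‖cellMoment p i (W n ω)‖ ^ 2)) ν := by
    rw [hmap] at hφint
    have h2 : Integrable (fun z => ∫ x, φ (z, x) ∂((cellKernel hp i).prodMkRight (Fin k → ℝ) z))
        (ν.map T) := by
      rw [Measure.compProd] at hφint
      simpa using hφint.integral_compProd
    simp only [hinner] at h2
    exact h2.comp_measurable hT
  rw [hL]
  refine integral_mono_ae (integrable_rate_mul_sq hp hsupp halg hrate n i).integrableOn hLint ?_
  have hmem : ∀ᵐ ω ∂ν, ω ∈ A ∩ P := ae_restrict_mem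
    ((halg.history_le n _ hA).inter (halg.history_le n _ hPm))
  filter_upwards [hmem, ae_restrict_of_ae (hrate.mem_Icc n i)] with ω h1 h2
  refine mul_le_mul_of_nonneg_left ?_ h2.1
  exact le_mul_of_one_le_left (by positivity)
    ((one_le_inv₀ h1.2).2 (mass_le_one hp _ _))

end Run

/-! ### Summability of the weighted squared gradients -/

section Summability

variable {Ω : Type*} {k d : ℕ} {p : Pt d → ℝ} {R : ℝ}

/-- The decrease `∑ i, H_i^(n+1) ‖∇_{w_i} f(W^(n))‖²` of the cost that a step is expected to
bring, with the gradient in its integral form. -/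
noncomputable def gain (p : Pt d → ℝ) (W : ℕ → Ω → Centers k d) (H : ℕ → Ω → Fin k → ℝ) (n : ℕ) (ω : Ω) : ℝ :=
  ∑ i, H (n + 1) ω i * ‖cellMoment p i (W n ω)‖ ^ 2

/-- The accumulated quadratic errors minus the accumulated gains and the current cost: the
submartingale that drives the convergence proof. -/
noncomputable def potential (p : Pt d → ℝ) (R : ℝ) (W : ℕ → Ω → Centers k d) (H : ℕ → Ω → Fin k → ℝ) (n : ℕ)
    (ω : Ω) : ℝ :=
  ∑ m ∈ Finset.range n, (2 * R ^ 2 * ∑ i, H (m + 1) ω i ^ 2 - gain p W H m ω) - cost p (W n ω)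

lemma potential_succ (p : Pt d → ℝ) (R : ℝ) (W : ℕ → Ω → Centers k d) (H : ℕ → Ω → Fin k → ℝ)
    (n : ℕ) (ω : Ω) :
    potential p R W H (n + 1) ω - potential p R W H n ω =
      2 * R ^ 2 * ∑ i, H (n + 1) ω i ^ 2 - gain p W H n ω + cost p (W n ω)
        - cost p (W (n + 1) ω) := by
  unfold potential
  rw [Finset.sum_range_succ]
  ring

lemma measurable_sum_mul_norm_cellMoment_sq (hp : IsDensity p) {m : MeasurableSpace Ω}
    {w : Ω → Centers k d} {h : Ω → Fin k → ℝ} (hw : Measurable w) (hh : Measurable h) :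
    Measurable fun ω => ∑ i, h ω i * ‖cellMoment p i (w ω)‖ ^ 2 :=
  Finset.measurable_fun_sum _ fun i _ => ((measurable_pi_apply i).comp hh).mul
    (((measurable_cellMoment hp i).comp hw).norm.pow_const 2)

variable [mΩ : MeasurableSpace Ω] {μ : Measure Ω}
  {W X : ℕ → Ω → Centers k d} {H : ℕ → Ω → Fin k → ℝ} [IsProbabilityMeasure μ]
  (hp : IsDensity p) (hsupp : law p {x | R < ‖x‖} = 0) (halg : IsOnlineKMeans μ p W X H)
  (hrate : RateAssumptions μ p W X H)

omit [IsProbabilityMeasure μ] in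
include hp halg in
lemma measurable_gain (n : ℕ) : Measurable[history W X H (n + 1)] (gain p W H n) :=
  measurable_sum_mul_norm_cellMoment_sq hp
    ((halg.measurable_centers n).mono (history_le_succ W X H n) le_rfl)
    (measurable_history_rate W X H n)

include hrate in
omit [IsProbabilityMeasure μ] in
lemma ae_gain_nonneg : ∀ᵐ ω ∂μ, ∀ n, 0 ≤ gain p W H n ω := by
  filter_upwards [ae_all_iff.2 fun n => ae_all_iff.2 (hrate.mem_Icc n)] with ω h n
  exact Finset.sum_nonneg fun i _ => mul_nonneg (h n i).1 (by positivity)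

include hp halg hrate

omit [IsProbabilityMeasure μ] hrate in
lemma measurable_potential (n : ℕ) : Measurable[history W X H n] (potential p R W H n) := by
  refine Measurable.sub (Finset.measurable_fun_sum _ fun m hm => ?_)
    ((measurable_cost hp).comp (halg.measurable_centers n))
  have hle : history W X H (m + 1) ≤ history W X H n :=
    halg.filtration.mono (Finset.mem_range.1 hm)
  refine Measurable.mono (Measurable.sub ?_ (measurable_gain hp halg m)) hle le_rfl
  refine (Finset.measurable_fun_sum _ fun i _ => ?_).const_mul _
  exact ((measurable_pi_apply i).comp (measurable_history_rate W X H m)).pow_const 2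

include hsupp

lemma integrable_gain (n : ℕ) : Integrable (gain p W H n) μ :=
  integrable_finsetSum _ fun i _ => integrable_rate_mul_sq hp hsupp halg hrate n i

omit hp hsupp in
lemma integrable_sum_rate_sq (n : ℕ) : Integrable (fun ω => ∑ i, H (n + 1) ω i ^ 2) μ := by
  refine integrable_finsetSum _ fun i _ => ?_
  refine Integrable.of_bound (((measurable_pi_apply i).comp
    (halg.measurable_rate n)).pow_const 2).aestronglyMeasurable 1 ?_
  filter_upwards [hrate.mem_Icc n i] with ω h
  rw [Real.norm_of_nonneg (by positivity)]
  exact pow_le_one₀ h.1 h.2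

lemma integrable_cost (n : ℕ) : Integrable (fun ω => cost p (W n ω)) μ := by
  refine Integrable.of_bound ((measurable_cost hp).comp
    (halg.measurable_centers' n)).aestronglyMeasurable (k * (2 * R) ^ 2) ?_
  filter_upwards [ae_mem_nondegenerateIn hp hsupp halg hrate] with ω h
  rw [Real.norm_of_nonneg (cost_nonneg _)]
  exact cost_le_of_mem hp hsupp (h n)

lemma integrable_potential (n : ℕ) : Integrable (potential p R W H n) μ :=
  (integrable_finsetSum _ fun m _ => ((integrable_sum_rate_sq halg hrate m).const_mul _).sub
    (integrable_gain hp hsupp halg hrate m)).sub (integrable_cost hp hsupp halg hrate n)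

/-- Descent along one step of the algorithm. -/
lemma ae_cost_succ_le : ∀ᵐ ω ∂μ, ∀ n, cost p (W (n + 1) ω) ≤ cost p (W n ω)
    - ∑ i, H (n + 1) ω i * inner ℝ (cellMoment p i (W n ω)) (W n ω i - X (n + 1) ω i)
    + 2 * R ^ 2 * ∑ i, H (n + 1) ω i ^ 2 := by
  filter_upwards [ae_mem_nondegenerateIn hp hsupp halg hrate,
    ae_rate_mul_norm_le hp hsupp halg hrate,
    ae_all_iff.2 fun n => ae_all_iff.2 (hrate.mem_Icc n)] with ω h1 h2 h3 n
  refine (cost_le hp hsupp (h1 (n + 1)).1 (W n ω)).trans ?_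
  rw [Finset.mul_sum, sub_add, ← Finset.sum_sub_distrib, sub_eq_add_neg, ← Finset.sum_neg_distrib]
  refine add_le_add_right (Finset.sum_le_sum fun i _ => ?_) _
  have e : W (n + 1) ω i - W n ω i = -(H (n + 1) ω i • (W n ω i - X (n + 1) ω i)) := by
    rw [halg.update]; abel
  rw [e, norm_neg, inner_neg_right, inner_smul_right, norm_smul, Real.norm_of_nonneg (h3 n i).1]
  have := pow_le_pow_left₀ (mul_nonneg (h3 n i).1 (norm_nonneg _)) (h2 n i) 2
  nlinarith

lemma submartingale_potential : Submartingale (potential p R W H) halg.filtration μ := by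
  refine submartingale_of_setIntegral_le_succ
    (fun n => (measurable_potential hp halg n).stronglyMeasurable)
    (integrable_potential hp hsupp halg hrate) fun n A hA => ?_
  have hI1 := (integrable_potential hp hsupp halg hrate (n + 1)).integrableOn (s := A)
  have hI0 := (integrable_potential hp hsupp halg hrate n).integrableOn (s := A)
  have hY : ∀ i ∈ Finset.univ, IntegrableOn (fun ω => H (n + 1) ω i *
      inner ℝ (cellMoment p i (W n ω)) (W n ω i - X (n + 1) ω i)) A μ := fun i _ =>
    (integrable_rate_mul_inner hp hsupp halg hrate n i).integrableOn
  have hG : ∀ i ∈ Finset.univ, IntegrableOn (fun ω => H (n + 1) ω i *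
      ‖cellMoment p i (W n ω)‖ ^ 2) A μ := fun i _ =>
    (integrable_rate_mul_sq hp hsupp halg hrate n i).integrableOn
  rw [← sub_nonneg, ← integral_sub hI1 hI0]
  calc (0 : ℝ) ≤ ∫ ω in A, (∑ i, H (n + 1) ω i *
          inner ℝ (cellMoment p i (W n ω)) (W n ω i - X (n + 1) ω i) - gain p W H n ω) ∂μ := by
        unfold gain
        rw [integral_sub (integrable_finsetSum _ hY) (integrable_finsetSum _ hG), sub_nonneg,
          integral_finsetSum _ hY, integral_finsetSum _ hG]
        exact Finset.sum_le_sum fun i _ => setIntegral_rate_mul_sq_le hp hsupp halg hrate n i hA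
    _ ≤ _ := by
        refine integral_mono_ae ((integrable_finsetSum _ hY).sub (integrable_finsetSum _ hG))
          (hI1.sub hI0) ?_
        filter_upwards [ae_restrict_of_ae (ae_cost_succ_le hp hsupp halg hrate)] with ω h
        rw [potential_succ]
        linarith [h n]

lemma ae_abs_potential_succ_sub_le : ∀ᵐ ω ∂μ, ∀ n,
    |potential p R W H (n + 1) ω - potential p R W H n ω| ≤
      2 * R ^ 2 * k + k * (R + |R|) ^ 2 + k * (2 * R) ^ 2 := by
  filter_upwards [ae_mem_nondegenerateIn hp hsupp halg hrate, ae_gain_nonneg hrate,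
    ae_all_iff.2 fun n => ae_all_iff.2 (hrate.mem_Icc n)] with ω h1 h2 h3 n
  rw [potential_succ]
  have a1 := cost_le_of_mem hp hsupp (h1 n)
  have a2 := cost_le_of_mem hp hsupp (h1 (n + 1))
  have b1 := cost_nonneg (p := p) (W n ω)
  have b2 := cost_nonneg (p := p) (W (n + 1) ω)
  have c1 : gain p W H n ω ≤ k * (R + |R|) ^ 2 := by
    refine (Finset.sum_le_sum fun i _ => ?_).trans (b := ∑ _i : Fin k, (R + |R|) ^ 2) (by simp)
    refine (mul_le_of_le_one_left (by positivity) (h3 n i).2).trans ?_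
    exact pow_le_pow_left₀ (norm_nonneg _)
      ((norm_cellMoment_le hp hsupp _ i).trans (by gcongr; exact (h1 n).2 i)) 2
  have c2 : ∑ i, H (n + 1) ω i ^ 2 ≤ k := by
    refine (Finset.sum_le_sum fun i _ => ?_).trans (b := ∑ _i : Fin k, (1 : ℝ)) (by simp)
    exact pow_le_one₀ (h3 n i).1 (h3 n i).2
  have c3 : 0 ≤ ∑ i, H (n + 1) ω i ^ 2 := Finset.sum_nonneg fun i _ => by positivity
  have c4 : 2 * R ^ 2 * ∑ i, H (n + 1) ω i ^ 2 ≤ 2 * R ^ 2 * k := by gcongr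
  have c5 : 0 ≤ 2 * R ^ 2 * ∑ i, H (n + 1) ω i ^ 2 := by positivity
  have c6 := h2 n
  rw [abs_le]
  constructor <;> linarith

/-- Square-summability of the rates bounds the potential above, so that it converges, and the
gains are summable. This avoids integrability of the sum of the squared rates. -/
lemma ae_summable_gain
    (hsq : ∀ᵐ ω ∂μ, Summable fun n : ℕ => ∑ i, H (n + 1) ω i ^ 2) :
    ∀ᵐ ω ∂μ, Summable fun n => gain p W H n ω := by
  have hconv := (submartingale_potential hp hsupp halg hrate).bddAbove_iff_exists_tendsto
    (R := ⟨2 * R ^ 2 * k + k * (R + |R|) ^ 2 + k * (2 * R) ^ 2, by positivity⟩)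
    (ae_abs_potential_succ_sub_le hp hsupp halg hrate)
  filter_upwards [hconv, hsq, ae_gain_nonneg (p := p) hrate] with ω h1 h2 h3
  have hQ : ∀ n, ∑ m ∈ Finset.range n, 2 * R ^ 2 * ∑ i, H (m + 1) ω i ^ 2 ≤
      2 * R ^ 2 * ∑' m, ∑ i, H (m + 1) ω i ^ 2 := fun n => by
    rw [← Finset.mul_sum]
    gcongr
    exact h2.sum_le_tsum _ fun m _ => Finset.sum_nonneg fun i _ => by positivity
  have hsplit : ∀ n, potential p R W H n ω =
      ∑ m ∈ Finset.range n, 2 * R ^ 2 * ∑ i, H (m + 1) ω i ^ 2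
        - ∑ m ∈ Finset.range n, gain p W H m ω - cost p (W n ω) := fun n => by
    rw [← Finset.sum_sub_distrib]; rfl
  have hb : BddAbove (range fun n => potential p R W H n ω) := by
    refine ⟨2 * R ^ 2 * ∑' m, ∑ i, H (m + 1) ω i ^ 2, ?_⟩
    rintro _ ⟨n, rfl⟩
    have a := Finset.sum_nonneg fun m (_ : m ∈ Finset.range n) => h3 m
    have b := cost_nonneg (p := p) (W n ω)
    simp only [hsplit]
    linarith [hQ n]
  obtain ⟨c, hc⟩ := h1.1 hb
  obtain ⟨B, hB⟩ := hc.bddBelow_range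
  refine summable_of_sum_range_le (c := 2 * R ^ 2 * ∑' m, ∑ i, H (m + 1) ω i ^ 2 - B) h3
    fun n => ?_
  have a : B ≤ potential p R W H n ω := hB ⟨n, rfl⟩
  have b := cost_nonneg (p := p) (W n ω)
  rw [hsplit] at a
  linarith [hQ n]

end Summability

/-! ### Visits to non-stationary regions -/

/-- A consequence of Lévy's upward theorem: if, whenever the past lies in `A m`, the event `B m`
has conditional probability at least `c`, and on both events a summable series collects `δ` over
a window starting at `m`, then only finitely many of the `A m` occur. -/
lemma ae_eventually_notMem_of_condProb {Ω : Type*} [mΩ : MeasurableSpace Ω] {μ : Measure Ω}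
    [IsProbabilityMeasure μ] {ℱ : Filtration ℕ mΩ} {A B : ℕ → Set Ω} {G : ℕ → Ω → ℝ} {T : ℕ → ℕ}
    {m₀ : ℕ} {δ c : ℝ} (hA : ∀ m, MeasurableSet[ℱ m] (A m)) (hB : ∀ m, MeasurableSet (B m))
    (hG : ∀ n, Measurable[ℱ (n + 1)] (G n)) (hδ : 0 < δ) (hc : 0 < c)
    (hsum : ∀ᵐ ω ∂μ, Summable fun n => G n ω)
    (hAB : ∀ᵐ ω ∂μ, ∀ m, ω ∈ A m → ω ∈ B m → δ ≤ ∑ n ∈ Finset.Ico m (T m), G n ω)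
    (hcond : ∀ m, m₀ < m → ∀ᵐ ω ∂μ, ω ∈ A m → c < (μ⟦B m | ℱ m⟧) ω) :
    ∀ᵐ ω ∂μ, ∀ᶠ m in atTop, ω ∉ A m := by
  -- `E M`: some window starting at time `M` or later collects `δ`; no `ω` with a convergent series
  -- lies in all the `E M`
  let E : ℕ → Set Ω := fun M => ⋃ m, ⋃ _ : M ≤ m, {ω | δ ≤ ∑ n ∈ Finset.Ico m (T m), G n ω}
  have hEmeas : ∀ M, MeasurableSet[⨆ n, ℱ n] (E M) := fun M => by
    refine MeasurableSet.iUnion fun m => MeasurableSet.iUnion fun _ => ?_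
    refine measurableSet_le measurable_const (Finset.measurable_fun_sum _ fun n _ => ?_)
    exact (hG n).mono (le_iSup (fun n => ℱ n) (n + 1)) le_rfl
  have hle : ⨆ n, ℱ n ≤ mΩ := iSup_le ℱ.le
  have hind : ∀ {D : Set Ω}, MeasurableSet D → Integrable (D.indicator fun _ => (1 : ℝ)) μ :=
    fun hD => (integrable_const _).indicator hD
  have hlevy : ∀ M, ∀ᵐ ω ∂μ, Tendsto (fun m => (μ⟦E M | ℱ m⟧) ω) atTop
      (𝓝 ((E M).indicator (fun _ => (1 : ℝ)) ω)) := fun M =>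
    (hind (hle _ (hEmeas M))).tendsto_ae_condExp (stronglyMeasurable_const.indicator (hEmeas M))
  have hlow : ∀ M m, ∀ᵐ ω ∂μ, M ≤ m → m₀ < m → ω ∈ A m → c < (μ⟦E M | ℱ m⟧) ω := by
    intro M m
    by_cases hMm : M ≤ m
    swap
    · exact .of_forall fun _ h => absurd h hMm
    by_cases hm : m₀ < m
    swap
    · exact .of_forall fun _ _ h => absurd h hm
    have hmono : (A m).indicator ((B m).indicator fun _ => (1 : ℝ)) ≤ᵐ[μ]
        (E M).indicator fun _ => (1 : ℝ) := by
      filter_upwards [hAB] with ω h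
      by_cases h1 : ω ∈ A m
      · by_cases h2 : ω ∈ B m
        · have h3 : ω ∈ E M := mem_iUnion₂.2 ⟨m, hMm, h m h1 h2⟩
          simp [h1, h2, h3]
        · simpa [h1, h2] using indicator_nonneg (fun _ _ => zero_le_one) ω
      · simpa [h1] using indicator_nonneg (fun _ _ => zero_le_one) ω
    filter_upwards [hcond m hm, condExp_indicator (hind (hB m)) (hA m),
      condExp_mono (m := ℱ m) ((hind (hB m)).indicator (ℱ.le m _ (hA m)))
        (hind (hle _ (hEmeas M))) hmono] with ω h1 h2 h3 _ _ hω
    rw [h2, indicator_of_mem hω] at h3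
    exact (h1 hω).trans_le h3
  filter_upwards [hsum, ae_all_iff.2 hlevy, ae_all_iff.2 fun M => ae_all_iff.2 (hlow M)]
    with ω h1 h2 h3
  by_contra hfreq
  have hfreq : ∃ᶠ m in atTop, ω ∈ A m := by simpa [Filter.Frequently] using hfreq
  have hmem : ∀ M, ω ∈ E M := by
    intro M
    by_contra hM
    have hlim := h2 M
    rw [indicator_of_notMem hM] at hlim
    obtain ⟨m, hm, hlt, hM', hm₀⟩ := (hfreq.and_eventually ((hlim.eventually_lt_const hc).and
      ((eventually_ge_atTop M).and (eventually_gt_atTop m₀)))).exists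
    exact lt_asymm hlt (h3 M m hM' hm₀ hm)
  obtain ⟨N, hN⟩ := Metric.cauchySeq_iff.1 h1.hasSum.tendsto_sum_nat.cauchySeq δ hδ
  obtain ⟨m, hm, hδm⟩ := mem_iUnion₂.1 (hmem N)
  have hδm : δ ≤ ∑ n ∈ Finset.Ico m (T m), G n ω := hδm
  rcases le_total m (T m) with hmT | hmT
  · rw [Finset.sum_Ico_eq_sub _ hmT] at hδm
    have := hN (T m) (hm.trans hmT) m hm
    rw [Real.dist_eq] at this
    linarith [le_abs_self (∑ n ∈ Finset.range (T m), G n ω - ∑ n ∈ Finset.range m, G n ω)]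
  · rw [Finset.Ico_eq_empty_of_le hmT, Finset.sum_empty] at hδm
    linarith

section Visits

variable {Ω : Type*} {k d : ℕ} {p : Pt d → ℝ} {R : ℝ} [mΩ : MeasurableSpace Ω] {μ : Measure Ω}
  {W X : ℕ → Ω → Centers k d} {H : ℕ → Ω → Fin k → ℝ}

/-- The centers travel a distance at most `2R` times the sum of all rates. -/
lemma dist_le_sum_rates (halg : IsOnlineKMeans μ p W X H) {ω : Ω} (hR : 0 ≤ R)
    (hH : ∀ n i, 0 ≤ H (n + 1) ω i)
    (hstep : ∀ n i, H (n + 1) ω i * ‖W n ω i - X (n + 1) ω i‖ ≤ H (n + 1) ω i * (2 * R))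
    {m n t : ℕ} (hmn : m ≤ n) (hnt : n ≤ t) :
    dist (W m ω) (W n ω) ≤ (∑ j, ∑ l ∈ Finset.Ico m t, H (l + 1) ω j) * (2 * R) := by
  have hone : ∀ l, dist (W l ω) (W (l + 1) ω) ≤ (∑ j, H (l + 1) ω j) * (2 * R) := by
    intro l
    have hsum : ∀ j, H (l + 1) ω j ≤ ∑ j, H (l + 1) ω j := fun j =>
      Finset.single_le_sum (fun i _ => hH l i) (Finset.mem_univ j)
    refine (dist_pi_le_iff (mul_nonneg (Finset.sum_nonneg fun i _ => hH l i)
      (by positivity))).2 fun j => ?_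
    rw [halg.update, dist_eq_norm, sub_sub_cancel, norm_smul, Real.norm_of_nonneg (hH l j)]
    exact (hstep l j).trans (mul_le_mul_of_nonneg_right (hsum j) (by positivity))
  refine (dist_le_Ico_sum_dist (fun l => W l ω) hmn).trans
    ((Finset.sum_le_sum fun l _ => hone l).trans ?_)
  rw [← Finset.sum_mul, Finset.sum_comm (s := Finset.univ)]
  refine mul_le_mul_of_nonneg_right ?_ (by positivity)
  exact Finset.sum_le_sum_of_subset_of_nonneg (Finset.Ico_subset_Ico_right hnt)
    fun l _ _ => Finset.sum_nonneg fun j _ => hH l j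

/-- On a window event the centers stay in a ball on which the gradient is large, so that the
window collects a definite amount of gain. -/
lemma le_sum_gain_of_mem_windowEvent (halg : IsOnlineKMeans μ p W X H) {ω : Ω} (hR : 0 < R)
    (hH : ∀ n i, 0 ≤ H (n + 1) ω i)
    (hstep : ∀ n i, H (n + 1) ω i * ‖W n ω i - X (n + 1) ω i‖ ≤ H (n + 1) ω i * (2 * R))
    {i : Fin k} {m t : ℕ} {r s ε ρ : ℝ} (hr : r * (2 * R) ≤ ρ) {w₀ : Centers k d} (hε : 0 ≤ ε)
    (hball : ∀ w ∈ Metric.ball w₀ (2 * ρ), ε < ‖cellMoment p i w‖)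
    (hm : W m ω ∈ Metric.ball w₀ ρ) (hω : ω ∈ windowEvent H i m t r s) :
    s * ε ^ 2 ≤ ∑ n ∈ Finset.Ico m t, gain p W H n ω := by
  refine (mul_le_mul_of_nonneg_right hω.2.le (sq_nonneg ε)).trans ?_
  rw [Finset.sum_mul]
  refine Finset.sum_le_sum fun n hn => ?_
  rw [Finset.mem_Ico] at hn
  have hd := dist_le_sum_rates halg hR.le hH hstep hn.1 hn.2.le
  have hlt := mul_lt_mul_of_pos_right hω.1 (by positivity : 0 < 2 * R)
  have hn' : W n ω ∈ Metric.ball w₀ (2 * ρ) := by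
    rw [Metric.mem_ball] at hm ⊢
    have := dist_triangle_left (W n ω) w₀ (W m ω)
    linarith
  calc H (n + 1) ω i * ε ^ 2 ≤ H (n + 1) ω i * ‖cellMoment p i (W n ω)‖ ^ 2 :=
        mul_le_mul_of_nonneg_left (pow_le_pow_left₀ hε (hball _ hn').le 2) (hH n i)
    _ ≤ gain p W H n ω := Finset.single_le_sum (f := fun j =>
        H (n + 1) ω j * ‖cellMoment p j (W n ω)‖ ^ 2)
        (fun j _ => mul_nonneg (hH n j) (by positivity)) (Finset.mem_univ i)

lemma measurableSet_windowEvent (halg : IsOnlineKMeans μ p W X H) (i : Fin k) (m t : ℕ)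
    (r s : ℝ) : MeasurableSet (windowEvent H i m t r s) := by
  have hH : ∀ n j, Measurable fun ω => H (n + 1) ω j := fun n j =>
    (measurable_pi_apply j).comp (halg.measurable_rate n)
  exact (measurableSet_lt (Finset.measurable_fun_sum _ fun j _ =>
      Finset.measurable_fun_sum _ fun n _ => hH n j) measurable_const).inter
    (measurableSet_lt measurable_const (Finset.measurable_fun_sum _ fun n _ => hH n i))

/-- Every non-stationary tuple of distinct centers has a neighborhood that is almost surely
visited only finitely often. -/
lemma exists_ball_eventually_notMem [IsProbabilityMeasure μ] (hp : IsDensity p) (hR : 0 < R)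
    (hsupp : law p {x | R < ‖x‖} = 0) (halg : IsOnlineKMeans μ p W X H)
    (hrate : RateAssumptions μ p W X H)
    (hsq : ∀ᵐ ω ∂μ, Summable fun n : ℕ => ∑ i, (H (n + 1) ω i) ^ 2)
    (hwindow : ∀ (i : Fin k) (ε : ℝ), 0 < ε → ∃ r₀ : ℝ, 0 < r₀ ∧ ∀ r : ℝ, 0 < r → r < r₀ →
      ∃ (T : ℕ → ℕ) (m₀ : ℕ) (s c : ℝ), 0 < s ∧ 0 < c ∧ ∀ m : ℕ, m₀ < m →
        ∀ᵐ ω ∂μ, ε < ‖gradCost p i (W m ω)‖ →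
          c < (μ⟦windowEvent H i m (T m) r s | history W X H m⟧) ω)
    {w₀ : Centers k d} (hw₀ : w₀ ∈ nondegenerate k d) (hns : w₀ ∉ stationary (cost p)) :
    ∃ ρ : ℝ, 0 < ρ ∧ ∀ᵐ ω ∂μ, ∀ᶠ m in atTop, W m ω ∉ Metric.ball w₀ ρ := by
  obtain ⟨i, hi⟩ : ∃ i, cellMoment p i w₀ ≠ 0 := by
    by_contra! h
    exact hns (mem_stationary hp hsupp hw₀ h)
  set ε := ‖cellMoment p i w₀‖ / 2 with hε
  have hpos := norm_pos_iff.2 hi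
  have hε0 : 0 < ε := by positivity
  obtain ⟨η, hη, hball⟩ := Metric.mem_nhds_iff.1
    ((continuousAt_cellMoment hp hsupp i hw₀).norm.eventually_const_lt (half_lt_self hpos))
  obtain ⟨r₀, hr₀, hwin⟩ := hwindow i ε hε0
  set ρ := η / 2 with hρ
  have hρ0 : 0 < ρ := by positivity
  have hball' : ∀ w ∈ Metric.ball w₀ (2 * ρ), ε < ‖cellMoment p i w‖ := fun w hw =>
    hball (by rwa [hρ, mul_div_cancel₀ η two_ne_zero] at hw)
  -- total rates below `r` over a window keep the displacement below `ρ`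
  set r := min (r₀ / 2) (ρ / (2 * R)) with hr
  have hr0 : 0 < r := lt_min (by positivity) (by positivity)
  have hrρ : r * (2 * R) ≤ ρ := by
    rw [← le_div_iff₀ (by positivity)]; exact min_le_right _ _
  obtain ⟨T, m₀, s, c, hs, hc, hT⟩ := hwin r hr0 ((min_le_left _ _).trans_lt (half_lt_self hr₀))
  refine ⟨ρ, hρ0, ae_eventually_notMem_of_condProb (ℱ := halg.filtration)
    (A := fun m => W m ⁻¹' Metric.ball w₀ ρ) (B := fun m => windowEvent H i m (T m) r s)
    (G := gain p W H) (T := T) (m₀ := m₀) (δ := s * ε ^ 2)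
    (fun m => halg.measurable_centers m Metric.isOpen_ball.measurableSet)
    (fun m => measurableSet_windowEvent halg i m _ r s) (measurable_gain hp halg)
    (by positivity) hc (ae_summable_gain hp hsupp halg hrate hsq) ?_ fun m hm => ?_⟩
  · filter_upwards [ae_rate_mul_norm_le hp hsupp halg hrate,
      ae_all_iff.2 fun n => ae_all_iff.2 (hrate.mem_Icc n)] with ω h1 h2 m hA hB
    exact le_sum_gain_of_mem_windowEvent halg hR (fun n i => (h2 n i).1) h1 hrρ hε0.le hball' hA hB
  · filter_upwards [hT m hm, ae_mem_nondegenerateIn hp hsupp halg hrate] with ω h1 h2 hω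
    refine h1 ?_
    rw [gradCost_eq_cellMoment hp hsupp i (h2 m).1]
    exact hball' _ (Metric.ball_subset_ball (by linarith) hω)

end Visits

end KMeans

theorem mainTheorem2 {Ω : Type*} [MeasurableSpace Ω] (μ : Measure Ω) [IsProbabilityMeasure μ]
    (k d : ℕ) (p : KMeans.Pt d → ℝ) (hp : KMeans.IsDensity p)
    (R : ℝ) (hR : 0 < R) (hsupp : KMeans.law p {x | R < ‖x‖} = 0)
    (W X : ℕ → Ω → KMeans.Centers k d) (H : ℕ → Ω → Fin k → ℝ)
    (halg : KMeans.IsOnlineKMeans μ p W X H)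
    (hrate : KMeans.RateAssumptions μ p W X H)
    (hcompact : IsCompact
      (KMeans.stationary (KMeans.cost (k := k) p) ∩ KMeans.nondegenerateIn k d R))
    (hsq : ∀ᵐ ω ∂μ, Summable fun n : ℕ => ∑ i, (H (n + 1) ω i) ^ 2)
    (hwindow : ∀ (i : Fin k) (ε : ℝ), 0 < ε → ∃ r₀ : ℝ, 0 < r₀ ∧ ∀ r : ℝ, 0 < r → r < r₀ →
      ∃ (T : ℕ → ℕ) (m₀ : ℕ) (s c : ℝ), 0 < s ∧ 0 < c ∧ ∀ m : ℕ, m₀ < m →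
        ∀ᵐ ω ∂μ, ε < ‖KMeans.gradCost p i (W m ω)‖ →
          c < (μ⟦KMeans.windowEvent H i m (T m) r s | KMeans.history W X H m⟧) ω) :
    ∀ᵐ ω ∂μ, KMeans.AsymptoticallyStationary (KMeans.nondegenerateIn k d R)
      (KMeans.cost p) (fun n => W n ω) := by
  have hnbhd : ∀ w : KMeans.Centers k d, ∃ ρ : ℝ, 0 < ρ ∧
      (w ∈ KMeans.nondegenerate k d → w ∉ KMeans.stationary (KMeans.cost p) →
        ∀ᵐ ω ∂μ, ∀ᶠ m in atTop, W m ω ∉ Metric.ball w ρ) := fun w => by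
    by_cases hw : w ∈ KMeans.nondegenerate k d ∧ w ∉ KMeans.stationary (KMeans.cost p)
    · obtain ⟨ρ, hρ, h⟩ := KMeans.exists_ball_eventually_notMem hp hR hsupp halg hrate hsq
        hwindow hw.1 hw.2
      exact ⟨ρ, hρ, fun _ _ => h⟩
    · exact ⟨1, one_pos, fun h1 h2 => absurd ⟨h1, h2⟩ hw⟩
  choose ρ hρ havoid using hnbhd
  obtain ⟨t, hts, htc, hcover⟩ := TopologicalSpace.countable_cover_nhdsWithin
    (s := KMeans.nondegenerate k d \ KMeans.stationary (KMeans.cost p))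
    (f := fun w => Metric.ball w (ρ w))
    fun w _ => mem_nhdsWithin_of_mem_nhds (Metric.ball_mem_nhds w (hρ w))
  filter_upwards [KMeans.ae_mem_nondegenerateIn hp hsupp halg hrate,
    (ae_ball_iff htc).2 fun w hw => havoid w (hts hw).1 (hts hw).2] with ω h1 h2
  refine ⟨h1, fun w hw => ?_⟩
  by_contra hns
  rw [mem_iInter] at hw
  obtain ⟨v, hv, hwv⟩ := mem_iUnion₂.1 (hcover ⟨(hw 0).1.1, hns⟩)
  obtain ⟨N, hN⟩ := eventually_atTop.1 (h2 v hv)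
  obtain ⟨_, hball, n, hn, rfl⟩ := mem_closure_iff.1 (hw N).2 _ Metric.isOpen_ball hwv
  exact hN n hn hball
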